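/- Let $\Theta$ be a finite set of states with a full-support common prior $p$, let $\ell\in\{1,\dots,L\}$ be agents with finite signal sets $X_\ell$, and put $X=X_1\times\dots\times X_L$. For each $\theta\in\Theta$ let $\pi^\theta$ be a probability distribution on $X$ with marginals $\phi^\theta_\ell$ on $X_\ell$. A state $\theta$ is drawn from $p$ and, conditional on $\theta$, signal profiles in periods $0,1,2,\dots$ are drawn i.i.d. from $\pi^\theta$; this defines a probability $\mathbb P$ on $\Omega=\Theta\times X^{\infty}$, with $\theta$-conditional versions $\mathbb P^\theta$. Agent $\ell$ observes only their own signals, and $h_{\ell t}$ is their history of signals in periods $0,\dots,t-1$. Assume that for all $\theta$ and all $\ell\neq\ell'$ the marginal of $\pi^\theta$ on $X_\ell\times X_{\ell'}$ has full support. For an event $F\subset\Omega$, let $B^q_t(F)=\{\omega:\mathbb P(F\mid h_{\ell t}(\omega))\ge q\text{ for all }\ell\}$; $F$ is $q$-evident at $t$ if $F\subset B^q_t(F)$. A set $Q\subset\Theta$, identified with the event $Q\times X^\infty$, is commonly learned if for every $q\in(0,1)$ there are a time $T$ and events $(F_t)_{t\ge0}$ such that for all $t\ge T$ and all $\theta\in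 Q$: (1) $F_t\subset B^q_t(Q)$; (2) $\mathbb P^\theta(F_t)>q$; (3) $F_t$ is $q$-evident at $t$. The identification partition $\mathcal Q_\ell$ of agent $\ell$ is the partition of $\Theta$ in which $\theta,\theta'$ share a cell if and only if $\phi^\theta_\ell=\phi^{\theta'}_\ell$. Let $\mathcal{QI}=\bigvee_\ell\mathcal Q_\ell$ be the finest partition of $\Theta$ whose cells are unions of cells of $\mathcal Q_\ell$ for every $\ell$. Then a set $Q\subset\Theta$ is commonly learned if and only if it is generated by $\mathcal{QI}$, that is, $Q$ is a (possibly empty) union of cells of $\mathcal{QI}$. -/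

import Mathlib

open MeasureTheory ProbabilityTheory

noncomputable section

/-- An information structure with state space `Θ`, agents `Fin L` and signal sets `X ℓ`:
a full-support common prior on the states and, for every state, a joint distribution of the
signal profile of one period. -/
structure InfoStructure (Θ : Type*) {L : ℕ} (X : Fin L → Type*) where
  /-- the common prior -/
  prior : PMF Θ
  /-- the prior has full support -/
  prior_pos : ∀ θ, 0 < prior θ
  /-- the joint distribution of signal profiles in each state -/
  signal : Θ → PMF (∀ ℓ, X ℓ)

namespace InfoStructure

variable {Θ : Type*} {L : ℕ} {X : Fin L → Type*}

/-- The marginal distribution of agent `ℓ`'s signal in state `θ`. -/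
def marginal (S : InfoStructure Θ X) (θ : Θ) (ℓ : Fin L) : PMF (X ℓ) :=
  (S.signal θ).map fun x => x ℓ

/-- The joint marginal distribution of the signals of agents `ℓ` and `ℓ'` in state `θ`. -/
def pairMarginal (S : InfoStructure Θ X) (θ : Θ) (ℓ ℓ' : Fin L) : PMF (X ℓ × X ℓ') :=
  (S.signal θ).map fun x => (x ℓ, x ℓ')

/-- In every state, the joint marginal of any two distinct agents' signals has full support. -/
def PairwiseFullSupport (S : InfoStructure Θ X) : Prop :=
  ∀ θ, ∀ ℓ ℓ' : Fin L, ℓ ≠ ℓ' → ∀ (a : X ℓ) (b : X ℓ'), 0 < S.pairMarginal θ ℓ ℓ' (a, b)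

/-- Agent `ℓ`'s identification partition, as an equivalence relation: two states are in the same
cell iff they give agent `ℓ` the same marginal signal distribution. -/
def identification (S : InfoStructure Θ X) (ℓ : Fin L) : Setoid Θ :=
  Setoid.ker fun θ => S.marginal θ ℓ

/-- The cells of the join of the identification partitions, i.e. of the finest partition whose
cells are unions of cells of every agent's identification partition. (In the order of `Setoid`,
larger means coarser.) -/
def commonIdentification (S : InfoStructure Θ X) : Set (Set Θ) :=
  (⨆ ℓ, S.identification ℓ).classes

/-- `Q` is generated by the join of the identification partitions: it is a union of its cells. -/
def CommonlyIdentified (S : InfoStructure Θ X) (Q : Set Θ) : Prop :=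
  ∃ C ⊆ S.commonIdentification, Q = ⋃₀ C

/-- States of the world: a state together with an infinite sequence of signal profiles. -/
abbrev World (Θ : Type*) {L : ℕ} (X : Fin L → Type*) : Type _ := Θ × (ℕ → ∀ ℓ, X ℓ)

/-- The history of agent `ℓ` at the start of period `t`: the signals of periods `0, …, t - 1`. -/
def history (ℓ : Fin L) (t : ℕ) (ω : World Θ X) : Fin t → X ℓ := fun s => ω.2 s ℓ

/-- The event that the state lies in `Q`. -/
def stateEvent (X : Fin L → Type*) (Q : Set Θ) : Set (World Θ X) := {ω | ω.1 ∈ Q}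

variable [MeasurableSpace Θ] [∀ ℓ, MeasurableSpace (X ℓ)]

/-- The law of the world conditional on the state `θ`: the state is `θ`, and the signal profiles
are drawn independently over time from the distribution `S.signal θ`. -/
def lawGiven (S : InfoStructure Θ X) (θ : Θ) : Measure (World Θ X) :=
  (Measure.dirac θ).prod (Measure.infinitePi fun _ : ℕ => (S.signal θ).toMeasure)

/-- The law of the world: the state is drawn from the prior. -/
def law [Fintype Θ] (S : InfoStructure Θ X) : Measure (World Θ X) :=
  ∑ θ, S.prior θ • S.lawGiven θ

/-- Agent `ℓ`'s posterior probability of the event `F` at time `t`, in the world `ω`: the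
conditional probability of `F` given the history of agent `ℓ` (`0` if this history has
probability zero). -/
def posterior [Fintype Θ] (S : InfoStructure Θ X) (ℓ : Fin L) (t : ℕ) (F : Set (World Θ X))
    (ω : World Θ X) : ℝ :=
  (cond S.law {ω' | history ℓ t ω' = history ℓ t ω}).real F

/-- The event that agent `ℓ` attaches at least probability `q` to `F` at time `t`. -/
def agentBelief [Fintype Θ] (S : InfoStructure Θ X) (q : ℝ) (ℓ : Fin L) (t : ℕ)
    (F : Set (World Θ X)) : Set (World Θ X) :=
  {ω | q ≤ S.posterior ℓ t F ω}

/-- The event that all agents attach at least probability `q` to `F` at time `t`. -/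
def belief [Fintype Θ] (S : InfoStructure Θ X) (q : ℝ) (t : ℕ) (F : Set (World Θ X)) :
    Set (World Θ X) :=
  ⋂ ℓ, S.agentBelief q ℓ t F

/-- `F` is `q`-evident at time `t`. -/
def IsEvident [Fintype Θ] (S : InfoStructure Θ X) (q : ℝ) (t : ℕ) (F : Set (World Θ X)) : Prop :=
  F ⊆ S.belief q t F

/-- Common learning of a set of states `Q`. -/
def CommonlyLearned [Fintype Θ] (S : InfoStructure Θ X) (Q : Set Θ) : Prop :=
  ∀ q ∈ Set.Ioo (0 : ℝ) 1, ∃ (T : ℕ) (F : ℕ → Set (World Θ X)),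
    (∀ t, MeasurableSet (F t)) ∧
      ∀ t ≥ T, ∀ θ ∈ Q,
        F t ⊆ S.belief q t (stateEvent X Q) ∧ q < (S.lawGiven θ).real (F t) ∧ S.IsEvident q t (F t)

end InfoStructure

end

/-!
Suppose that `Q` is closed under every agent's indistinguishability of states. The events that
witness common learning say that the state lies in `Q` and every agent's signal counts up to time
`t` deviate from their mean, in `ℓ¹`, by at most `t * δ`. By Hoeffding's inequality they are likely.
They are evident because an agent whose counts deviate by at most `t * δ` expects the counts of
another agent to deviate by at most `(1 - κ) * t * δ`: by full support, all rows of the transition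
kernel between the signals of two agents share a common mass `κ > 0`, so this kernel contracts the
`ℓ¹` distance, and the gap `κ * t * δ` absorbs the conditional fluctuations. States that an agent
can tell apart from the true one become negligible, because for small `δ` their likelihood at a
typical history is exponentially smaller than that of the true state.

Conversely, two states with the same marginal for agent `ℓ` give `ℓ`'s histories the same law. If
just one of them lies in `Q`, then agent `ℓ` believes `Q` in the other one almost as often as in the
first, which contradicts the average correctness of posterior beliefs.
-/

open Filter Topology

section EmpiricalCounts

variable {ι α β : Type*} [Fintype ι]

/-- The number of occurrences of the letter `a` in the word `h`, as a real number. -/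
noncomputable def empiricalCount (h : ι → α) (a : α) : ℝ :=
  ∑ i, ({a} : Set α).indicator 1 (h i)

variable [Fintype α]

theorem sum_empiricalCount_mul (h : ι → α) (f : α → ℝ) :
    ∑ a, empiricalCount h a * f a = ∑ i, f (h i) := by
  classical
  simp only [empiricalCount, Finset.sum_mul, Set.indicator_apply, Set.mem_singleton_iff]
  rw [Finset.sum_comm]
  simp

/-- The `ℓ¹`-distance between the letter counts of the word `h` and the counts expected under the
distribution `p`. Counts are not normalized, so this is `card ι` times the distance between the
empirical distribution and `p`. -/
noncomputable def deviation (p : α → ℝ) (h : ι → α) : ℝ :=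
  ∑ a, |empiricalCount h a - Fintype.card ι * p a|

theorem sum_empiricalCount_sub {p : α → ℝ} (hp : ∑ a, p a = 1) (h : ι → α) :
    ∑ a, (empiricalCount h a - Fintype.card ι * p a) = 0 := by
  have hcount : ∑ a, empiricalCount h a = Fintype.card ι := by
    simpa using sum_empiricalCount_mul h fun _ => 1
  rw [Finset.sum_sub_distrib, hcount, ← Finset.mul_sum, hp, mul_one, sub_self]

theorem sum_comp_sub_eq_sum_empiricalCount_sub_mul (p g : α → ℝ) (h : ι → α) :
    ∑ i, g (h i) - Fintype.card ι * ∑ a, p a * g a =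
      ∑ a, (empiricalCount h a - Fintype.card ι * p a) * g a := by
  simp only [sub_mul, Finset.sum_sub_distrib, sum_empiricalCount_mul, mul_assoc, ← Finset.mul_sum]

theorem sum_comp_sub_le_deviation_mul (p g : α → ℝ) (h : ι → α) :
    ∑ i, g (h i) - Fintype.card ι * ∑ a, p a * g a ≤ deviation p h * ∑ a, |g a| := by
  have hterm (a : α) : (empiricalCount h a - Fintype.card ι * p a) * g a ≤
      |empiricalCount h a - Fintype.card ι * p a| * ∑ a, |g a| :=
    calc (empiricalCount h a - Fintype.card ι * p a) * g a
        ≤ |empiricalCount h a - Fintype.card ι * p a| * |g a| := by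
          rw [← abs_mul]
          exact le_abs_self _
      _ ≤ _ := mul_le_mul_of_nonneg_left
          (Finset.single_le_sum (f := fun a => |g a|) (fun _ _ => abs_nonneg _)
            (Finset.mem_univ a)) (abs_nonneg _)
  rw [sum_comp_sub_eq_sum_empiricalCount_sub_mul, deviation, Finset.sum_mul]
  exact Finset.sum_le_sum fun a _ => hterm a

-- Dobrushin's contraction estimate: `m` can be subtracted from the kernel since `∑ a, v a = 0`.
theorem sum_abs_sum_mul_le_of_sum_eq_zero [Fintype β] {v : α → ℝ} (hv : ∑ a, v a = 0)
    {K : α → β → ℝ} (hK : ∀ a, ∑ b, K a b = 1) {m : ℝ} (hm : ∀ a b, m ≤ K a b) :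
    ∑ b, |∑ a, v a * K a b| ≤ (1 - Fintype.card β * m) * ∑ a, |v a| := by
  have hshift (b : β) : ∑ a, v a * K a b = ∑ a, v a * (K a b - m) := by
    simp only [mul_sub, Finset.sum_sub_distrib, ← Finset.sum_mul, hv, zero_mul, sub_zero]
  calc ∑ b, |∑ a, v a * K a b| ≤ ∑ b, ∑ a, |v a| * (K a b - m) := by
        gcongr with b
        rw [hshift]
        refine (Finset.abs_sum_le_sum_abs _ _).trans_eq (Finset.sum_congr rfl fun a _ => ?_)
        rw [abs_mul, abs_of_nonneg (sub_nonneg.2 (hm a b))]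
    _ = (1 - Fintype.card β * m) * ∑ a, |v a| := by
        rw [Finset.sum_comm, Finset.mul_sum]
        refine Finset.sum_congr rfl fun a _ => ?_
        rw [← Finset.mul_sum, Finset.sum_sub_distrib, hK, Finset.sum_const, Finset.card_univ,
          nsmul_eq_mul, mul_comm]

theorem sum_abs_sum_kernel_sub_le_mul_deviation [Fintype β] {p : α → ℝ} (hp : ∑ a, p a = 1)
    {K : α → β → ℝ} (hK : ∀ a, ∑ b, K a b = 1) {m : ℝ} (hm : ∀ a b, m ≤ K a b) (h : ι → α) :
    ∑ b, |∑ i, K (h i) b - Fintype.card ι * ∑ a, p a * K a b| ≤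
      (1 - Fintype.card β * m) * deviation p h := by
  calc ∑ b, |∑ i, K (h i) b - Fintype.card ι * ∑ a, p a * K a b|
      = ∑ b, |∑ a, (empiricalCount h a - Fintype.card ι * p a) * K a b| :=
        Finset.sum_congr rfl fun b _ => by
          rw [sum_comp_sub_eq_sum_empiricalCount_sub_mul p (K · b)]
    _ ≤ _ := sum_abs_sum_mul_le_of_sum_eq_zero (sum_empiricalCount_sub hp h) hK hm

end EmpiricalCounts

section Typicality

variable {ι α : Type*} [Fintype ι] [Fintype α]

/-- The word `h` is `δ`-typical for the distribution `p`: each of its letters has positive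
probability and its empirical distribution is within `ℓ¹`-distance `δ` of `p`. The inequality is
multiplied by the length of `h`, which makes the empty word typical. -/
def IsTypical (p : α → ℝ) (δ : ℝ) (h : ι → α) : Prop :=
  (∀ i, 0 < p (h i)) ∧ deviation p h ≤ Fintype.card ι * δ

theorem mul_sqrt_div_eq_sqrt_mul {x : ℝ} (hx : 0 ≤ x) (y : ℝ) : x * √(y / x) = √(x * y) := by
  rcases hx.eq_or_lt with rfl | hx
  · simp
  · rw [show x * y = x ^ 2 * (y / x) by field_simp, Real.sqrt_mul (sq_nonneg x),
      Real.sqrt_sq hx.le]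

theorem sum_sqrt_mul_lt_one {p p' : α → ℝ} (hp : p ∈ stdSimplex ℝ α) (hp' : p' ∈ stdSimplex ℝ α)
    (hne : p ≠ p') : ∑ a, √(p a * p' a) < 1 := by
  have hmean (a : α) : √(p a * p' a) ≤ (p a + p' a) / 2 :=
    (Real.sqrt_le_left (by linarith [hp.1 a, hp'.1 a])).2
      (by linarith [sq_nonneg (p a - p' a)])
  obtain ⟨a, ha⟩ := Function.ne_iff.1 hne
  have hmean_strict : √(p a * p' a) < (p a + p' a) / 2 := by
    rw [Real.sqrt_lt (mul_nonneg (hp.1 a) (hp'.1 a)) (by linarith [hp.1 a, hp'.1 a])]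
    linarith [sq_pos_of_ne_zero (sub_ne_zero.2 ha)]
  calc ∑ a, √(p a * p' a) < ∑ a, (p a + p' a) / 2 :=
        Finset.sum_lt_sum (fun a _ => hmean a) ⟨a, Finset.mem_univ a, hmean_strict⟩
    _ = 1 := by
        rw [← Finset.sum_div, Finset.sum_add_distrib, hp.2, hp'.2]
        norm_num

theorem le_exp_sqrt_div_sub_one_mul {x y : ℝ} (hx : 0 < x) (hy : 0 ≤ y) :
    y ≤ Real.exp (2 * (√(y / x) - 1)) * x := by
  rw [← div_le_iff₀ hx]
  calc y / x = √(y / x) ^ 2 := (Real.sq_sqrt (by positivity)).symm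
    _ ≤ Real.exp (√(y / x) - 1) ^ 2 := by
        gcongr
        linarith [Real.add_one_le_exp (√(y / x) - 1)]
    _ = Real.exp (2 * (√(y / x) - 1)) := by
        rw [← Real.exp_nat_mul]
        norm_num

-- `log (p' a / p a)` is unbounded where `p' a = 0`; its majorant `2 * (√(p' a / p a) - 1)` is
-- finite and still has negative mean under `p`.
theorem prod_le_exp_mul_prod_of_isTypical {p p' : α → ℝ} (hp : p ∈ stdSimplex ℝ α)
    (hp' : ∀ a, 0 ≤ p' a) {δ : ℝ} {h : ι → α} (hh : IsTypical p δ h) :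
    ∏ i, p' (h i) ≤
      Real.exp (Fintype.card ι * (2 * (∑ a, √(p a * p' a) - 1) +
        δ * ∑ a, |2 * (√(p' a / p a) - 1)|)) * ∏ i, p (h i) := by
  set g : α → ℝ := fun a => 2 * (√(p' a / p a) - 1)
  have hmean : ∑ a, p a * g a = 2 * (∑ a, √(p a * p' a) - 1) := by
    rw [← hp.2, ← Finset.sum_sub_distrib, Finset.mul_sum]
    refine Finset.sum_congr rfl fun a _ => ?_
    rw [← mul_sqrt_div_eq_sqrt_mul (hp.1 a)]
    ring
  have hsum : ∑ i, g (h i) ≤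
      Fintype.card ι * (2 * (∑ a, √(p a * p' a) - 1) + δ * ∑ a, |g a|) := by
    have hdev : deviation p h * ∑ a, |g a| ≤ Fintype.card ι * δ * ∑ a, |g a| :=
      mul_le_mul_of_nonneg_right hh.2 (by positivity)
    have hsub := sum_comp_sub_le_deviation_mul p g h
    rw [hmean] at hsub
    linarith
  calc ∏ i, p' (h i) ≤ ∏ i, Real.exp (g (h i)) * p (h i) :=
        Finset.prod_le_prod (fun i _ => hp' _) fun i _ =>
          le_exp_sqrt_div_sub_one_mul (hh.1 i) (hp' _)
    _ = Real.exp (∑ i, g (h i)) * ∏ i, p (h i) := by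
        rw [Finset.prod_mul_distrib, Real.exp_sum]
    _ ≤ _ := by
        gcongr
        exact Finset.prod_nonneg fun i _ => hp.1 _

theorem eventually_prod_le_exp_neg_mul_prod_of_isTypical {p p' : α → ℝ}
    (hp : p ∈ stdSimplex ℝ α) (hp' : p' ∈ stdSimplex ℝ α) (hne : p ≠ p') :
    ∀ᶠ δ in 𝓝[>] (0 : ℝ), ∀ (t : ℕ) (h : Fin t → α), IsTypical p δ h →
      ∏ i, p' (h i) ≤ Real.exp (-(t * δ)) * ∏ i, p (h i) := by
  set B := ∑ a, |2 * (√(p' a / p a) - 1)|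
  have hlim : Tendsto (fun δ : ℝ => 2 * (∑ a, √(p a * p' a) - 1) + δ * B + δ) (𝓝[>] 0)
      (𝓝 (2 * (∑ a, √(p a * p' a) - 1) + 0 * B + 0)) :=
    tendsto_nhdsWithin_of_tendsto_nhds (Continuous.tendsto (by fun_prop) 0)
  have hneg : 2 * (∑ a, √(p a * p' a) - 1) + 0 * B + 0 < 0 := by
    linarith [sum_sqrt_mul_lt_one hp hp' hne]
  filter_upwards [hlim.eventually_lt_const hneg] with δ hδ t h hh
  refine (prod_le_exp_mul_prod_of_isTypical hp hp'.1 hh).trans ?_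
  rw [Fintype.card_fin, ← mul_neg]
  gcongr
  · exact Finset.prod_nonneg fun i _ => hp.1 _
  · linarith

end Typicality

section Concentration

variable {Ω : Type*} [MeasurableSpace Ω] {μ : Measure Ω}

theorem measureReal_le_abs_le_of_hasSubgaussianMGF [IsFiniteMeasure μ] {Y : Ω → ℝ} {c : NNReal}
    (hY : HasSubgaussianMGF Y c μ) {ε : ℝ} (hε : 0 ≤ ε) :
    μ.real {ω | ε ≤ |Y ω|} ≤ 2 * Real.exp (-ε ^ 2 / (2 * c)) :=
  calc μ.real {ω | ε ≤ |Y ω|} ≤ μ.real ({ω | ε ≤ Y ω} ∪ {ω | ε ≤ (-Y) ω}) :=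
        measureReal_mono fun _ hω => le_abs.1 (Set.mem_ofPred.1 hω)
    _ ≤ μ.real {ω | ε ≤ Y ω} + μ.real {ω | ε ≤ (-Y) ω} := measureReal_union_le _ _
    _ ≤ 2 * Real.exp (-ε ^ 2 / (2 * c)) := by
        linarith [hY.measure_ge_le hε, hY.neg.measure_ge_le hε]

variable {ι α : Type*} [Fintype ι] [MeasurableSpace α] [MeasurableSingletonClass α] {ξ : ι → Ω → α}

theorem measureReal_le_abs_empiricalCount_sub_le [IsProbabilityMeasure μ]
    (hξ : ∀ i, Measurable (ξ i)) (hindep : iIndepFun ξ μ) (a : α) {ε : ℝ} (hε : 0 ≤ ε) :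
    μ.real {ω | ε ≤ |empiricalCount (ξ · ω) a - ∑ i, μ.real (ξ i ⁻¹' {a})|} ≤
      2 * Real.exp (-2 * ε ^ 2 / Fintype.card ι) := by
  set Y : ι → Ω → ℝ := fun i ω => ({a} : Set α).indicator 1 (ξ i ω)
  have hind : Measurable (({a} : Set α).indicator (1 : α → ℝ)) :=
    measurable_one.indicator (measurableSet_singleton a)
  have hmean (i : ι) : μ[Y i] = μ.real (ξ i ⁻¹' {a}) :=
    integral_indicator_one (hξ i (measurableSet_singleton a))
  have hsub (i : ι) : HasSubgaussianMGF (fun ω => Y i ω - μ[Y i]) ((‖(1 : ℝ) - 0‖₊ / 2) ^ 2) μ :=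
    hasSubgaussianMGF_of_mem_Icc (hind.comp (hξ i)).aemeasurable <| ae_of_all _ fun ω =>
      ⟨Set.indicator_nonneg (fun _ _ => zero_le_one) _,
        Set.indicator_le_self' (fun _ _ => zero_le_one) _⟩
  have hcentered : iIndepFun (fun i ω => Y i ω - μ[Y i]) μ :=
    hindep.comp (fun i (b : α) => ({a} : Set α).indicator (1 : α → ℝ) b - ∫ ω, Y i ω ∂μ)
      fun i => hind.sub_const _
  have htail := measureReal_le_abs_le_of_hasSubgaussianMGF
    (HasSubgaussianMGF.sum_of_iIndepFun hcentered fun i (_ : i ∈ Finset.univ) => hsub i) hε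
  have hexponent : -ε ^ 2 / (2 * (∑ _i : ι, (‖(1 : ℝ) - 0‖₊ / 2) ^ 2 : NNReal)) =
      -2 * ε ^ 2 / Fintype.card ι := by
    simp only [sub_zero, nnnorm_one, one_div, inv_pow, Finset.sum_const, Finset.card_univ,
      nsmul_eq_mul, NNReal.coe_mul, NNReal.coe_natCast, NNReal.coe_inv, NNReal.coe_pow,
      NNReal.coe_ofNat]
    ring
  rw [hexponent] at htail
  simpa only [empiricalCount, hmean, Finset.sum_sub_distrib] using htail

variable [Fintype α]

theorem measureReal_lt_sum_abs_empiricalCount_sub_le [IsProbabilityMeasure μ]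
    (hξ : ∀ i, Measurable (ξ i)) (hindep : iIndepFun ξ μ) {η : ℝ} (hη : 0 ≤ η) :
    μ.real {ω | Fintype.card ι * (Fintype.card α * η) <
        ∑ a, |empiricalCount (ξ · ω) a - ∑ i, μ.real (ξ i ⁻¹' {a})|} ≤
      Fintype.card α * (2 * Real.exp (-2 * Fintype.card ι * η ^ 2)) := by
  set D : α → Ω → ℝ := fun a ω => |empiricalCount (ξ · ω) a - ∑ i, μ.real (ξ i ⁻¹' {a})|
  have hcover : {ω | Fintype.card ι * (Fintype.card α * η) < ∑ a, D a ω} ⊆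
      ⋃ a, {ω | Fintype.card ι * η ≤ D a ω} := fun ω hω => by
    by_contra hnot
    simp only [Set.mem_iUnion, Set.mem_ofPred_eq, not_exists, not_le] at hnot hω
    refine hω.not_ge ((Finset.sum_le_card_nsmul _ _ _ fun a _ => (hnot a).le).trans_eq ?_)
    rw [Finset.card_univ, nsmul_eq_mul, mul_left_comm]
  have hexponent : -2 * (Fintype.card ι * η) ^ 2 / Fintype.card ι =
      -2 * Fintype.card ι * η ^ 2 := by
    rcases Nat.eq_zero_or_pos (Fintype.card ι) with hι | hι
    · simp [hι]
    · field_simp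
  calc μ.real {ω | Fintype.card ι * (Fintype.card α * η) < ∑ a, D a ω}
      ≤ ∑ a, μ.real {ω | Fintype.card ι * η ≤ D a ω} :=
        (measureReal_mono hcover).trans (measureReal_iUnion_fintype_le _)
    _ ≤ ∑ _a : α, 2 * Real.exp (-2 * Fintype.card ι * η ^ 2) := by
        rw [← hexponent]
        exact Finset.sum_le_sum fun a _ =>
          measureReal_le_abs_empiricalCount_sub_le hξ hindep a (by positivity)
    _ = Fintype.card α * (2 * Real.exp (-2 * Fintype.card ι * η ^ 2)) := by
        rw [Finset.sum_const, Finset.card_univ, nsmul_eq_mul]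

theorem measureReal_lt_deviation_le [IsProbabilityMeasure μ] (hξ : ∀ i, Measurable (ξ i))
    (hindep : iIndepFun ξ μ) {p : α → ℝ} {r η : ℝ} (hη : 0 ≤ η)
    (hr : ∑ a, |∑ i, μ.real (ξ i ⁻¹' {a}) - Fintype.card ι * p a| ≤ r) :
    μ.real {ω | r + Fintype.card ι * (Fintype.card α * η) < deviation p (ξ · ω)} ≤
      Fintype.card α * (2 * Real.exp (-2 * Fintype.card ι * η ^ 2)) := by
  refine (measureReal_mono fun ω hω => ?_).trans
    (measureReal_lt_sum_abs_empiricalCount_sub_le hξ hindep hη)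
  have htriangle : deviation p (ξ · ω) ≤
      ∑ a, |empiricalCount (ξ · ω) a - ∑ i, μ.real (ξ i ⁻¹' {a})| +
        ∑ a, |∑ i, μ.real (ξ i ⁻¹' {a}) - Fintype.card ι * p a| := by
    rw [deviation, ← Finset.sum_add_distrib]
    exact Finset.sum_le_sum fun a _ => abs_sub_le _ _ _
  simp only [Set.mem_ofPred_eq] at hω ⊢
  linarith

theorem measureReal_cond_lt_deviation_le {β : Type*} [Fintype β] [MeasurableSpace β]
    [MeasurableSingletonClass β] {ζ : ι → Ω → β} (hζ : ∀ i, Measurable (ζ i))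
    (hξ : ∀ i, Measurable (ξ i)) (hindep : iIndepFun (fun i ω => (ζ i ω, ξ i ω)) μ)
    {K : α → β → ℝ} (hK : ∀ i a b, (μ[|ξ i ⁻¹' {a}]).real (ζ i ⁻¹' {b}) = K a b)
    (hrow : ∀ a, ∑ b, K a b = 1) {m : ℝ} (hm₀ : 0 ≤ m) (hm : ∀ a b, m ≤ K a b)
    {p : α → ℝ} (hp : ∑ a, p a = 1) {δ : ℝ} (hδ : 0 ≤ δ) {h : ι → α}
    (hpos : ∀ i, μ (ξ i ⁻¹' {h i}) ≠ 0) (hh : deviation p h ≤ Fintype.card ι * δ) :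
    (μ[|⋂ i, ξ i ⁻¹' {h i}]).real
        {ω | Fintype.card ι * δ < deviation (fun b => ∑ a, p a * K a b) (ζ · ω)} ≤
      Fintype.card β * (2 * Real.exp (-2 * Fintype.card ι * (m * δ) ^ 2)) := by
  have hmeas (i : ι) : MeasurableSet ({h i} : Set α) := measurableSet_singleton _
  have hindep' : iIndepFun ζ μ[|⋂ i, ξ i ⁻¹' {h i}] := hindep.cond hξ hpos hmeas
  have := hindep'.isProbabilityMeasure
  have hlaw (i : ι) (b : β) :
      (μ[|⋂ i, ξ i ⁻¹' {h i}]).real (ζ i ⁻¹' {b}) = K (h i) b := by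
    have hprod := cond_iInter (s := {i}) (f := fun i => ζ i ⁻¹' {b}) hξ hindep
      (fun i _ => ⟨{b}, measurableSet_singleton b, rfl⟩) (fun i _ => hpos i) hmeas
    simp only [Finset.mem_singleton, Set.iInter_iInter_eq_left, Finset.prod_singleton] at hprod
    rw [← hK i, measureReal_def, hprod, measureReal_def]
  have hcard : Fintype.card β * m ≤ 1 := by
    obtain ⟨a, -, -⟩ := Finset.exists_ne_zero_of_sum_ne_zero (hp.trans_ne one_ne_zero)
    rw [← hrow a, ← nsmul_eq_mul]
    exact Finset.card_nsmul_le_sum _ _ _ fun b _ => hm a b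
  have hdrift : ∑ b, |∑ i, (μ[|⋂ i, ξ i ⁻¹' {h i}]).real (ζ i ⁻¹' {b}) -
      Fintype.card ι * ∑ a, p a * K a b| ≤
        Fintype.card ι * δ - Fintype.card ι * (Fintype.card β * (m * δ)) := by
    simp only [hlaw]
    refine (sum_abs_sum_kernel_sub_le_mul_deviation hp hrow hm h).trans ?_
    calc (1 - Fintype.card β * m) * deviation p h
        ≤ (1 - Fintype.card β * m) * (Fintype.card ι * δ) :=
          mul_le_mul_of_nonneg_left hh (sub_nonneg.2 hcard)
      _ = Fintype.card ι * δ - Fintype.card ι * (Fintype.card β * (m * δ)) := by ring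
  simpa only [sub_add_cancel] using
    measureReal_lt_deviation_le hζ hindep' (mul_nonneg hm₀ hδ) hdrift

end Concentration

section Decay

theorem eventually_exp_neg_mul_le {c ε : ℝ} (hc : 0 < c) (hε : 0 < ε) :
    ∀ᶠ t : ℕ in atTop, Real.exp (-(t * c)) ≤ ε :=
  (Real.tendsto_exp_neg_atTop_nhds_zero.comp
    (tendsto_natCast_atTop_atTop.atTop_mul_const hc)).eventually_le_const hε

theorem eventually_mul_two_mul_exp_le (N : ℕ) {c ε : ℝ} (hc : 0 < c) (hε : 0 < ε) :
    ∀ᶠ t : ℕ in atTop, N * (2 * Real.exp (-2 * t * c ^ 2)) ≤ ε := by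
  have hbound : 0 < ε / (2 * N + 1) := by positivity
  filter_upwards [eventually_exp_neg_mul_le (c := 2 * c ^ 2) (by positivity) hbound] with t ht
  rw [le_div_iff₀ (by positivity)] at ht
  rw [show -2 * t * c ^ 2 = -(t * (2 * c ^ 2)) by ring]
  nlinarith [Real.exp_pos (-(t * (2 * c ^ 2)))]

end Decay

theorem sum_toReal_pmf {α : Type*} [Fintype α] (p : PMF α) : ∑ a, (p a).toReal = 1 := by
  rw [← ENNReal.toReal_sum fun a _ => p.apply_ne_top a, ← tsum_fintype (L := .unconditional _),
    PMF.tsum_coe, ENNReal.toReal_one]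

namespace InfoStructure

variable {Θ : Type*} {L : ℕ} {X : Fin L → Type*} (S : InfoStructure Θ X)

section Frequencies

/-- The real-valued probability mass function of agent `ℓ`'s signal in state `θ`, i.e. the limiting
signal frequencies of agent `ℓ`. -/
noncomputable def freq (θ : Θ) (ℓ : Fin L) (a : X ℓ) : ℝ :=
  (S.marginal θ ℓ a).toReal

theorem freq_mem_stdSimplex [∀ ℓ, Fintype (X ℓ)] (θ : Θ) (ℓ : Fin L) :
    S.freq θ ℓ ∈ stdSimplex ℝ (X ℓ) :=
  ⟨fun _ => ENNReal.toReal_nonneg, sum_toReal_pmf (S.marginal θ ℓ)⟩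

theorem freq_eq_freq_iff {θ θ' : Θ} {ℓ : Fin L} :
    S.freq θ ℓ = S.freq θ' ℓ ↔ S.marginal θ ℓ = S.marginal θ' ℓ := by
  refine ⟨fun h => PMF.ext fun a => ?_, fun h => by unfold freq; rw [h]⟩
  exact (ENNReal.toReal_eq_toReal_iff' (PMF.apply_ne_top _ _) (PMF.apply_ne_top _ _)).1
    (congrFun h a)

variable [∀ ℓ, MeasurableSpace (X ℓ)] [∀ ℓ, MeasurableSingletonClass (X ℓ)]

theorem signal_toMeasure_real_eval_preimage (θ : Θ) (ℓ : Fin L) (a : X ℓ) :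
    (S.signal θ).toMeasure.real (Function.eval ℓ ⁻¹' {a}) = S.freq θ ℓ a := by
  rw [freq, marginal, ← PMF.toMeasure_apply_singleton _ a (measurableSet_singleton a),
    PMF.toMeasure_map_apply _ _ _ (measurable_pi_apply ℓ) (measurableSet_singleton a)]
  rfl

theorem signal_toMeasure_eval_preimage_ne_zero {θ : Θ} {ℓ : Fin L} {a : X ℓ}
    (ha : 0 < S.freq θ ℓ a) : (S.signal θ).toMeasure (Function.eval ℓ ⁻¹' {a}) ≠ 0 := by
  rw [← signal_toMeasure_real_eval_preimage] at ha
  exact (measureReal_ne_zero_iff).1 ha.ne'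

/-- The probability that agent `ℓ'` receives the signal `b` in a period in which agent `ℓ` receives
the signal `a`, in state `θ` (`0` if the signal `a` has probability zero). -/
noncomputable def condFreq (θ : Θ) (ℓ ℓ' : Fin L) (a : X ℓ) (b : X ℓ') : ℝ :=
  ((S.signal θ).toMeasure[|Function.eval ℓ ⁻¹' {a}]).real (Function.eval ℓ' ⁻¹' {b})

theorem freq_mul_condFreq (θ : Θ) (ℓ ℓ' : Fin L) (a : X ℓ) (b : X ℓ') :
    S.freq θ ℓ a * S.condFreq θ ℓ ℓ' a b =
      (S.signal θ).toMeasure.real (Function.eval ℓ ⁻¹' {a} ∩ Function.eval ℓ' ⁻¹' {b}) := by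
  rw [← signal_toMeasure_real_eval_preimage, condFreq, measureReal_def, measureReal_def,
    measureReal_def, ← ENNReal.toReal_mul, mul_comm,
    cond_mul_eq_inter (measurable_pi_apply ℓ (measurableSet_singleton a))]

theorem sum_freq_mul_condFreq [∀ ℓ, Fintype (X ℓ)] (θ : Θ) (ℓ ℓ' : Fin L) (b : X ℓ') :
    ∑ a, S.freq θ ℓ a * S.condFreq θ ℓ ℓ' a b = S.freq θ ℓ' b := by
  set B : Set (∀ ℓ, X ℓ) := Function.eval ℓ' ⁻¹' {b}
  set μ := (S.signal θ).toMeasure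
  have hfiber (a : X ℓ) : MeasurableSet (Function.eval ℓ ⁻¹' {a} : Set (∀ ℓ, X ℓ)) :=
    measurable_pi_apply ℓ (measurableSet_singleton a)
  calc ∑ a, S.freq θ ℓ a * S.condFreq θ ℓ ℓ' a b
      = ∑ a, (μ.restrict B).real (Function.eval ℓ ⁻¹' {a}) := by
        simp only [freq_mul_condFreq, measureReal_restrict_apply (hfiber _), μ, B]
    _ = (μ.restrict B).real Set.univ := by
        rw [sum_measureReal_preimage_singleton _ fun a _ => hfiber a, Finset.coe_univ,
          Set.preimage_univ]
    _ = S.freq θ ℓ' b := by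
        rw [measureReal_restrict_apply_univ, signal_toMeasure_real_eval_preimage]

theorem toReal_pairMarginal (θ : Θ) (ℓ ℓ' : Fin L) (a : X ℓ) (b : X ℓ') :
    (S.pairMarginal θ ℓ ℓ' (a, b)).toReal =
      (S.signal θ).toMeasure.real (Function.eval ℓ ⁻¹' {a} ∩ Function.eval ℓ' ⁻¹' {b}) := by
  rw [pairMarginal, ← PMF.toMeasure_apply_singleton _ _ (measurableSet_singleton _),
    PMF.toMeasure_map_apply _ _ _ (by fun_prop) (measurableSet_singleton _),
    ← Set.singleton_prod_singleton]
  rfl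

variable {S}

theorem PairwiseFullSupport.freq_mul_condFreq_pos (hS : S.PairwiseFullSupport) (θ : Θ)
    {ℓ ℓ' : Fin L} (hℓ : ℓ ≠ ℓ') (a : X ℓ) (b : X ℓ') :
    0 < S.freq θ ℓ a * S.condFreq θ ℓ ℓ' a b := by
  rw [freq_mul_condFreq, ← toReal_pairMarginal]
  exact ENNReal.toReal_pos (hS θ ℓ ℓ' hℓ a b).ne' (PMF.apply_ne_top _ _)

theorem PairwiseFullSupport.condFreq_pos (hS : S.PairwiseFullSupport) (θ : Θ)
    {ℓ ℓ' : Fin L} (hℓ : ℓ ≠ ℓ') (a : X ℓ) (b : X ℓ') : 0 < S.condFreq θ ℓ ℓ' a b :=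
  pos_of_mul_pos_right (hS.freq_mul_condFreq_pos θ hℓ a b) ENNReal.toReal_nonneg

theorem PairwiseFullSupport.freq_pos (hS : S.PairwiseFullSupport) (θ : Θ)
    {ℓ ℓ' : Fin L} (hℓ : ℓ ≠ ℓ') (a : X ℓ) : 0 < S.freq θ ℓ a :=
  pos_of_mul_pos_left
    (hS.freq_mul_condFreq_pos θ hℓ a ((S.signal θ).support_nonempty.some ℓ')) measureReal_nonneg

variable [∀ ℓ, Fintype (X ℓ)]

theorem PairwiseFullSupport.sum_condFreq (hS : S.PairwiseFullSupport) (θ : Θ)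
    {ℓ ℓ' : Fin L} (hℓ : ℓ ≠ ℓ') (a : X ℓ) : ∑ b, S.condFreq θ ℓ ℓ' a b = 1 := by
  have := cond_isProbabilityMeasure (S.signal_toMeasure_eval_preimage_ne_zero (hS.freq_pos θ hℓ a))
  simp only [condFreq]
  rw [sum_measureReal_preimage_singleton _ fun b _ =>
      measurable_pi_apply ℓ' (measurableSet_singleton b), Finset.coe_univ, Set.preimage_univ,
    probReal_univ]

theorem PairwiseFullSupport.exists_le_condFreq [Finite Θ] (hS : S.PairwiseFullSupport) :
    ∃ m > (0 : ℝ), (∀ ℓ, Fintype.card (X ℓ) * m ≤ 1) ∧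
      ∀ θ ℓ ℓ', ℓ ≠ ℓ' → ∀ a b, m ≤ S.condFreq θ ℓ ℓ' a b := by
  have hcard : ∀ᶠ m : ℝ in 𝓝[>] 0, ∀ ℓ, Fintype.card (X ℓ) * m ≤ 1 := by
    refine eventually_all.2 fun ℓ => ?_
    have hlim : Tendsto (fun m : ℝ => Fintype.card (X ℓ) * m) (𝓝[>] 0)
        (𝓝 (Fintype.card (X ℓ) * 0)) :=
      tendsto_nhdsWithin_of_tendsto_nhds (tendsto_id.const_mul _)
    exact hlim.eventually_le_const (by simp)
  have hcond : ∀ᶠ m : ℝ in 𝓝[>] 0, ∀ θ ℓ ℓ', ℓ ≠ ℓ' → ∀ a b, m ≤ S.condFreq θ ℓ ℓ' a b := by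
    simp only [eventually_all]
    exact fun θ ℓ ℓ' hℓ a b =>
      (eventually_le_nhds (hS.condFreq_pos θ hℓ a b)).filter_mono nhdsWithin_le_nhds
  exact (eventually_mem_nhdsWithin.and (hcard.and hcond)).exists

end Frequencies

section LawGivenState

variable [MeasurableSpace Θ] [∀ ℓ, MeasurableSpace (X ℓ)]

instance isProbabilityMeasure_lawGiven (θ : Θ) : IsProbabilityMeasure (S.lawGiven θ) := by
  unfold lawGiven
  infer_instance

theorem measurable_history (ℓ : Fin L) (t : ℕ) :
    Measurable (history ℓ t : World Θ X → Fin t → X ℓ) :=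
  measurable_pi_lambda _ fun s => by unfold history; fun_prop

theorem ae_fst_eq [MeasurableSingletonClass Θ] (θ : Θ) : ∀ᵐ ω ∂S.lawGiven θ, ω.1 = θ := by
  rw [lawGiven, Measure.dirac_prod]
  exact (ae_map_iff (by fun_prop) (measurable_fst (measurableSet_singleton θ))).2
    (ae_of_all _ fun _ => rfl)

theorem measurePreserving_profile (θ : Θ) (s : ℕ) :
    MeasurePreserving (fun ω : World Θ X => ω.2 s) (S.lawGiven θ) (S.signal θ).toMeasure :=
  (measurePreserving_eval_infinitePi _ s).comp measurePreserving_snd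

theorem iIndepFun_profile (θ : Θ) :
    iIndepFun (fun (s : ℕ) (ω : World Θ X) => ω.2 s) (S.lawGiven θ) := by
  rw [iIndepFun_iff_map_fun_eq_infinitePi_map (by fun_prop)]
  simp only [(S.measurePreserving_profile θ _).map_eq]
  exact measurePreserving_snd.map_eq

theorem iIndepFun_signal (θ : Θ) (ℓ : Fin L) (t : ℕ) :
    iIndepFun (fun (s : Fin t) (ω : World Θ X) => ω.2 s ℓ) (S.lawGiven θ) :=
  ((S.iIndepFun_profile θ).precomp Fin.val_injective).comp (fun _ => Function.eval ℓ)
    fun _ => measurable_pi_apply ℓ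

theorem map_history_lawGiven (θ : Θ) (ℓ : Fin L) (t : ℕ) :
    (S.lawGiven θ).map (history ℓ t) = Measure.pi fun _ => (S.marginal θ ℓ).toMeasure := by
  have hlaw (s : Fin t) :
      (S.lawGiven θ).map (fun ω : World Θ X => ω.2 s ℓ) = (S.marginal θ ℓ).toMeasure := by
    rw [marginal, ← PMF.toMeasure_map _ _ (measurable_pi_apply ℓ),
      ← (S.measurePreserving_profile θ s).map_eq,
      Measure.map_map (measurable_pi_apply ℓ) (by fun_prop)]
    rfl
  have hmap := (S.iIndepFun_signal θ ℓ t).map_fun_eq_pi_map fun s => by fun_prop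
  simp only [hlaw] at hmap
  exact hmap

variable [∀ ℓ, MeasurableSingletonClass (X ℓ)]

theorem measurableSet_history_eq (ℓ : Fin L) {t : ℕ} (h : Fin t → X ℓ) :
    MeasurableSet {ω : World Θ X | history ℓ t ω = h} :=
  measurable_history ℓ t (measurableSet_singleton h)

theorem lawGiven_real_history_eq (θ : Θ) (ℓ : Fin L) {t : ℕ}
    (h : Fin t → X ℓ) :
    (S.lawGiven θ).real {ω | history ℓ t ω = h} = ∏ s, S.freq θ ℓ (h s) := by
  have hmap := map_measureReal_apply (μ := S.lawGiven θ) (measurable_history ℓ t)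
    (measurableSet_singleton h)
  rw [map_history_lawGiven, measureReal_def, Measure.pi_singleton, ENNReal.toReal_prod] at hmap
  simp only [PMF.toMeasure_apply_singleton _ _ (measurableSet_singleton _)] at hmap
  exact hmap.symm

theorem lawGiven_real_eval_preimage (θ : Θ) (s : ℕ) (ℓ : Fin L) (a : X ℓ) :
    (S.lawGiven θ).real ((fun ω => ω.2 s ℓ) ⁻¹' {a}) = S.freq θ ℓ a := by
  rw [← signal_toMeasure_real_eval_preimage]
  exact (S.measurePreserving_profile θ s).measureReal_preimage
    (measurable_pi_apply ℓ (measurableSet_singleton a)).nullMeasurableSet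

theorem cond_lawGiven_real_eval_preimage (θ : Θ) (s : ℕ) (ℓ ℓ' : Fin L) (a : X ℓ) (b : X ℓ') :
    ((S.lawGiven θ)[|(fun ω => ω.2 s ℓ) ⁻¹' {a}]).real ((fun ω => ω.2 s ℓ') ⁻¹' {b}) =
      S.condFreq θ ℓ ℓ' a b := by
  have hpres := S.measurePreserving_profile θ s
  have hA : MeasurableSet (Function.eval ℓ ⁻¹' {a} : Set (∀ ℓ, X ℓ)) :=
    measurable_pi_apply ℓ (measurableSet_singleton a)
  have hB : MeasurableSet (Function.eval ℓ' ⁻¹' {b} : Set (∀ ℓ, X ℓ)) :=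
    measurable_pi_apply ℓ' (measurableSet_singleton b)
  rw [condFreq, measureReal_def, measureReal_def, cond_apply hA,
    ← hpres.measure_preimage hA.nullMeasurableSet,
    ← hpres.measure_preimage (hA.inter hB).nullMeasurableSet, Set.preimage_inter,
    ← cond_apply (hpres.measurable hA)]
  rfl

theorem ae_forall_freq_pos [∀ ℓ, Countable (X ℓ)] (θ : Θ) (ℓ : Fin L) :
    ∀ᵐ ω ∂S.lawGiven θ, ∀ s, 0 < S.freq θ ℓ (ω.2 s ℓ) := by
  refine ae_all_iff.2 fun s => ?_
  have hletter (a : X ℓ) : ∀ᵐ ω ∂S.lawGiven θ, ω.2 s ℓ = a → 0 < S.freq θ ℓ a := by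
    have hnonneg : 0 ≤ S.freq θ ℓ a := ENNReal.toReal_nonneg
    rcases hnonneg.eq_or_lt with ha | ha
    · rw [← lawGiven_real_eval_preimage (s := s), eq_comm, measureReal_eq_zero_iff] at ha
      filter_upwards [measure_eq_zero_iff_ae_notMem.1 ha] with ω hω hωa using absurd hωa hω
    · exact ae_of_all _ fun _ _ => ha
  filter_upwards [ae_all_iff.2 hletter] with ω hω using hω _ rfl

variable [∀ ℓ, Fintype (X ℓ)]

theorem lawGiven_real_lt_deviation_history_le (θ : Θ) (ℓ : Fin L) (t : ℕ) {η : ℝ} (hη : 0 ≤ η) :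
    (S.lawGiven θ).real
        {ω | t * (Fintype.card (X ℓ) * η) < deviation (S.freq θ ℓ) (history ℓ t ω)} ≤
      Fintype.card (X ℓ) * (2 * Real.exp (-2 * t * η ^ 2)) := by
  have hdrift : ∑ a, |∑ s : Fin t, (S.lawGiven θ).real ((fun ω => ω.2 s ℓ) ⁻¹' {a}) -
      Fintype.card (Fin t) * S.freq θ ℓ a| ≤ 0 := by
    simp [lawGiven_real_eval_preimage]
  have htail := measureReal_lt_deviation_le (fun _ => by fun_prop) (S.iIndepFun_signal θ ℓ t) hη
    hdrift
  simp only [zero_add, Fintype.card_fin] at htail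
  exact htail

variable {S}

theorem PairwiseFullSupport.cond_lawGiven_real_lt_deviation_history_le
    (hS : S.PairwiseFullSupport) (θ : Θ) {ℓ ℓ' : Fin L} (hℓ : ℓ ≠ ℓ') {m : ℝ} (hm₀ : 0 ≤ m)
    (hm : ∀ a b, m ≤ S.condFreq θ ℓ ℓ' a b) {δ : ℝ} (hδ : 0 ≤ δ) {t : ℕ} {h : Fin t → X ℓ}
    (hh : deviation (S.freq θ ℓ) h ≤ t * δ) :
    ((S.lawGiven θ)[|{ω | history ℓ t ω = h}]).real
        {ω | t * δ < deviation (S.freq θ ℓ') (history ℓ' t ω)} ≤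
      Fintype.card (X ℓ') * (2 * Real.exp (-2 * t * (m * δ) ^ 2)) := by
  have hindep : iIndepFun (fun (s : Fin t) (ω : World Θ X) => (ω.2 s ℓ', ω.2 s ℓ))
      (S.lawGiven θ) :=
    ((S.iIndepFun_profile θ).precomp Fin.val_injective).comp (fun _ x => (x ℓ', x ℓ))
      fun _ => by fun_prop
  have hpos (s : Fin t) : S.lawGiven θ ((fun ω => ω.2 s ℓ) ⁻¹' {h s}) ≠ 0 :=
    (measureReal_ne_zero_iff).1 <| by
      rw [lawGiven_real_eval_preimage]
      exact (hS.freq_pos θ hℓ (h s)).ne'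
  have hevent : {ω : World Θ X | history ℓ t ω = h} =
      ⋂ s : Fin t, (fun ω => ω.2 s ℓ) ⁻¹' {h s} := by
    ext ω
    simp [history, funext_iff]
  have htail := measureReal_cond_lt_deviation_le (fun _ => by fun_prop) (fun _ => by fun_prop)
    hindep (fun s => S.cond_lawGiven_real_eval_preimage θ s ℓ ℓ') (hS.sum_condFreq θ hℓ) hm₀ hm
    (S.freq_mem_stdSimplex θ ℓ).2 hδ hpos (by rwa [Fintype.card_fin])
  simp only [sum_freq_mul_condFreq, Fintype.card_fin] at htail
  rw [hevent]
  exact htail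

variable (S)

/-- The event that the state lies in `Q` and the history of every agent up to time `t` is
`δ`-typical for the realized state: the events that witness common learning of `Q`. -/
def typicalEvent (Q : Set Θ) (δ : ℝ) (t : ℕ) : Set (World Θ X) :=
  {ω | ω.1 ∈ Q ∧ ∀ ℓ, IsTypical (S.freq ω.1 ℓ) δ (history ℓ t ω)}

theorem measurableSet_typicalEvent [Countable Θ] [MeasurableSingletonClass Θ] (Q : Set Θ) (δ : ℝ)
    (t : ℕ) : MeasurableSet (S.typicalEvent Q δ t) := by
  have hmeas : Measurable fun ω : World Θ X => (ω.1, fun ℓ => history ℓ t ω) :=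
    measurable_fst.prodMk (measurable_pi_lambda _ fun ℓ => measurable_history ℓ t)
  exact hmeas (MeasurableSet.of_discrete
    (s := {x : Θ × ∀ ℓ, Fin t → X ℓ | x.1 ∈ Q ∧ ∀ ℓ, IsTypical (S.freq x.1 ℓ) δ (x.2 ℓ)}))

variable [MeasurableSingletonClass Θ] {Q : Set Θ} {θ : Θ}

theorem measureReal_compl_typicalEvent_le (hθ : θ ∈ Q) {μ : Measure (World Θ X)}
    [IsFiniteMeasure μ] (hμ : μ ≪ S.lawGiven θ) {δ ε : ℝ} {t : ℕ}
    (hdev : ∀ ℓ, μ.real {ω | t * δ < deviation (S.freq θ ℓ) (history ℓ t ω)} ≤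
      Fintype.card (X ℓ) * ε) :
    μ.real (S.typicalEvent Q δ t)ᶜ ≤ (∑ ℓ, Fintype.card (X ℓ) : ℕ) * ε := by
  have hcover : (S.typicalEvent Q δ t)ᶜ ≤ᵐ[μ]
      ⋃ ℓ, {ω | t * δ < deviation (S.freq θ ℓ) (history ℓ t ω)} := by
    filter_upwards [hμ.ae_le (S.ae_fst_eq θ),
      hμ.ae_le (ae_all_iff.2 (S.ae_forall_freq_pos θ))] with ω hωθ hpos hω
    refine Set.mem_iUnion.2 (by_contra fun hnot => hω ?_)
    simp only [Set.mem_ofPred_eq, not_exists, not_lt] at hnot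
    subst hωθ
    exact ⟨hθ, fun ℓ => ⟨fun s => hpos ℓ s, by simpa only [Fintype.card_fin] using hnot ℓ⟩⟩
  calc μ.real (S.typicalEvent Q δ t)ᶜ
      ≤ μ.real (⋃ ℓ, {ω | t * δ < deviation (S.freq θ ℓ) (history ℓ t ω)}) :=
        ENNReal.toReal_mono (measure_ne_top _ _) (measure_mono_ae hcover)
    _ ≤ ∑ ℓ, Fintype.card (X ℓ) * ε :=
        (measureReal_iUnion_fintype_le _).trans (Finset.sum_le_sum fun ℓ _ => hdev ℓ)
    _ = (∑ ℓ, Fintype.card (X ℓ) : ℕ) * ε := by rw [Nat.cast_sum, Finset.sum_mul]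

theorem lawGiven_real_compl_typicalEvent_le (hθ : θ ∈ Q) {m δ : ℝ} (hm₀ : 0 ≤ m)
    (hm : ∀ ℓ, Fintype.card (X ℓ) * m ≤ 1) (hδ : 0 ≤ δ) (t : ℕ) :
    (S.lawGiven θ).real (S.typicalEvent Q δ t)ᶜ ≤
      (∑ ℓ, Fintype.card (X ℓ) : ℕ) * (2 * Real.exp (-2 * t * (m * δ) ^ 2)) := by
  refine S.measureReal_compl_typicalEvent_le hθ Measure.AbsolutelyContinuous.rfl fun ℓ => ?_
  have hshrink : Fintype.card (X ℓ) * (m * δ) ≤ δ := by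
    simpa only [mul_assoc, one_mul] using mul_le_mul_of_nonneg_right (hm ℓ) hδ
  refine (measureReal_mono fun ω hω => ?_).trans
    (S.lawGiven_real_lt_deviation_history_le θ ℓ t (mul_nonneg hm₀ hδ))
  exact (mul_le_mul_of_nonneg_left hshrink t.cast_nonneg).trans_lt (Set.mem_ofPred.1 hω)

variable {S}

theorem PairwiseFullSupport.lawGiven_real_history_diff_typicalEvent_le
    (hS : S.PairwiseFullSupport) (hθ : θ ∈ Q) {m δ : ℝ} (hm₀ : 0 ≤ m)
    (hm : ∀ ℓ ℓ', ℓ ≠ ℓ' → ∀ a b, m ≤ S.condFreq θ ℓ ℓ' a b) (hδ : 0 ≤ δ) {ℓ : Fin L} {t : ℕ}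
    {h : Fin t → X ℓ} (hh : IsTypical (S.freq θ ℓ) δ h) :
    (S.lawGiven θ).real ({ω | history ℓ t ω = h} \ S.typicalEvent Q δ t) ≤
      (∑ ℓ, Fintype.card (X ℓ) : ℕ) * (2 * Real.exp (-2 * t * (m * δ) ^ 2)) *
        (S.lawGiven θ).real {ω | history ℓ t ω = h} := by
  set H : Set (World Θ X) := {ω | history ℓ t ω = h}
  have hH : MeasurableSet H := measurableSet_history_eq ℓ h
  have hdev : deviation (S.freq θ ℓ) h ≤ t * δ := by simpa only [Fintype.card_fin] using hh.2
  have hothers (ℓ' : Fin L) :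
      ((S.lawGiven θ)[|H]).real {ω | t * δ < deviation (S.freq θ ℓ') (history ℓ' t ω)} ≤
        Fintype.card (X ℓ') * (2 * Real.exp (-2 * t * (m * δ) ^ 2)) := by
    rcases eq_or_ne ℓ ℓ' with rfl | hℓ
    · have hown : ((S.lawGiven θ)[|H]).real
          {ω | t * δ < deviation (S.freq θ ℓ) (history ℓ t ω)} = 0 := by
        refine (measureReal_eq_zero_iff).2 (measure_eq_zero_iff_ae_notMem.2 ?_)
        filter_upwards [ae_cond_mem hH] with ω hω hlt
        exact hdev.not_gt (Set.mem_ofPred.1 hω ▸ Set.mem_ofPred.1 hlt)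
      rw [hown]
      positivity
    · exact hS.cond_lawGiven_real_lt_deviation_history_le θ hℓ hm₀ (hm ℓ ℓ' hℓ) hδ hdev
  have hcompl := S.measureReal_compl_typicalEvent_le hθ cond_absolutelyContinuous hothers
  rw [Set.sdiff_eq, measureReal_def, ← cond_mul_eq_inter hH, ENNReal.toReal_mul]
  exact mul_le_mul_of_nonneg_right hcompl measureReal_nonneg

end LawGivenState

section Law

theorem prior_toReal_pos (θ : Θ) : 0 < (S.prior θ).toReal :=
  ENNReal.toReal_pos (S.prior_pos θ).ne' (PMF.apply_ne_top _ _)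

variable [Fintype Θ] [MeasurableSpace Θ] [∀ ℓ, MeasurableSpace (X ℓ)]

theorem law_real (A : Set (World Θ X)) :
    S.law.real A = ∑ θ, (S.prior θ).toReal * (S.lawGiven θ).real A := by
  simp only [law, measureReal_def, Measure.finsetSum_apply, Measure.smul_apply, smul_eq_mul]
  rw [ENNReal.toReal_sum fun θ _ => ENNReal.mul_ne_top (PMF.apply_ne_top _ _) (measure_ne_top _ _)]
  simp only [ENNReal.toReal_mul]

instance isProbabilityMeasure_law : IsProbabilityMeasure S.law := by
  refine isProbabilityMeasure_iff_real.2 ?_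
  rw [law_real]
  simp only [probReal_univ, mul_one, sum_toReal_pmf]

theorem prior_mul_lawGiven_real_le_law_real (θ : Θ) (A : Set (World Θ X)) :
    (S.prior θ).toReal * (S.lawGiven θ).real A ≤ S.law.real A := by
  rw [law_real]
  exact Finset.single_le_sum
    (f := fun θ => (S.prior θ).toReal * (S.lawGiven θ).real A)
    (fun _ _ => mul_nonneg ENNReal.toReal_nonneg measureReal_nonneg) (Finset.mem_univ θ)

variable [∀ ℓ, MeasurableSingletonClass (X ℓ)]

theorem posterior_mul_law_real (ℓ : Fin L) (t : ℕ) (F : Set (World Θ X)) (ω : World Θ X) :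
    S.posterior ℓ t F ω * S.law.real {ω' | history ℓ t ω' = history ℓ t ω} =
      S.law.real ({ω' | history ℓ t ω' = history ℓ t ω} ∩ F) := by
  rw [posterior, measureReal_def, measureReal_def, ← ENNReal.toReal_mul,
    cond_mul_eq_inter (measurableSet_history_eq ℓ (history ℓ t ω)), measureReal_def]

end Law

section CommonIdentification

theorem commonlyIdentified_iff {Q : Set Θ} : S.CommonlyIdentified Q ↔
    ∀ ℓ, ∀ θ ∈ Q, ∀ θ', S.marginal θ ℓ = S.marginal θ' ℓ → θ' ∈ Q := by
  constructor
  · rintro ⟨C, hC, rfl⟩ ℓ θ ⟨c, hc, hθ⟩ θ' hmarginal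
    obtain ⟨θ₀, rfl⟩ := hC hc
    have hle : S.identification ℓ ≤ ⨆ ℓ, S.identification ℓ := le_iSup _ ℓ
    exact ⟨_, hc, Setoid.trans' _ (hle hmarginal.symm) hθ⟩
  · intro hclosed
    have hle : (⨆ ℓ, S.identification ℓ) ≤ Setoid.ker (· ∈ Q) :=
      iSup_le fun ℓ θ θ' hθ =>
        propext ⟨fun hmem => hclosed ℓ θ hmem θ' hθ, fun hmem => hclosed ℓ θ' hmem θ hθ.symm⟩
    refine ⟨{c ∈ S.commonIdentification | c ⊆ Q}, fun c hc => hc.1,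
      Set.Subset.antisymm (fun θ hθ => ?_) (Set.sUnion_subset fun c hc => hc.2)⟩
    exact ⟨{θ' | (⨆ ℓ, S.identification ℓ) θ' θ},
      ⟨⟨θ, rfl⟩, fun θ' hθ' => (hle hθ').mpr hθ⟩, Setoid.refl' (⨆ ℓ, S.identification ℓ) θ⟩

end CommonIdentification

section Sufficiency

variable [Fintype Θ] [MeasurableSpace Θ] [∀ ℓ, MeasurableSpace (X ℓ)]

theorem law_real_le_mul_law_real {A B : Set (World Θ X)} {ε ε' : ℝ} (hε : 0 ≤ ε) (hε' : 0 ≤ ε')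
    (h : ∀ θ, (S.lawGiven θ).real A ≤ ε * (S.lawGiven θ).real B ∨
      (S.lawGiven θ).real A ≤ ε' * S.law.real B) :
    S.law.real A ≤ (ε + ε') * S.law.real B :=
  calc S.law.real A
      ≤ ∑ θ, (S.prior θ).toReal * (ε * (S.lawGiven θ).real B + ε' * S.law.real B) := by
        rw [law_real]
        refine Finset.sum_le_sum fun θ _ => mul_le_mul_of_nonneg_left ?_ ENNReal.toReal_nonneg
        rcases h θ with h | h
        · exact h.trans (le_add_of_nonneg_right (by positivity))
        · exact h.trans (le_add_of_nonneg_left (by positivity))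
    _ = ε * ∑ θ, (S.prior θ).toReal * (S.lawGiven θ).real B +
          (∑ θ, (S.prior θ).toReal) * (ε' * S.law.real B) := by
        rw [Finset.mul_sum, Finset.sum_mul, ← Finset.sum_add_distrib]
        exact Finset.sum_congr rfl fun θ _ => by ring
    _ = (ε + ε') * S.law.real B := by rw [← law_real, sum_toReal_pmf]; ring

theorem belief_mono (q : ℝ) (t : ℕ) {F G : Set (World Θ X)} (hFG : F ⊆ G) :
    S.belief q t F ⊆ S.belief q t G :=
  Set.iInter_mono fun _ _ hω => le_trans (Set.mem_ofPred.1 hω) (measureReal_mono hFG)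

variable [∀ ℓ, MeasurableSingletonClass (X ℓ)]

theorem lawGiven_real_history_eq_le_mul_law_real {θ θ' : Θ} {ℓ : Fin L}
    {t : ℕ} {h : Fin t → X ℓ} {r ε : ℝ} (hε : 0 ≤ ε)
    (hlik : ∏ s, S.freq θ' ℓ (h s) ≤ r * ∏ s, S.freq θ ℓ (h s))
    (hr : r ≤ ε * (S.prior θ).toReal) :
    (S.lawGiven θ').real {ω | history ℓ t ω = h} ≤ ε * S.law.real {ω | history ℓ t ω = h} := by
  simp only [← lawGiven_real_history_eq] at hlik
  calc (S.lawGiven θ').real {ω | history ℓ t ω = h}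
      ≤ ε * (S.prior θ).toReal * (S.lawGiven θ).real {ω | history ℓ t ω = h} :=
        hlik.trans (mul_le_mul_of_nonneg_right hr measureReal_nonneg)
    _ ≤ ε * S.law.real {ω | history ℓ t ω = h} := by
        rw [mul_assoc]
        exact mul_le_mul_of_nonneg_left (S.prior_mul_lawGiven_real_le_law_real θ _) hε

theorem le_posterior_of_law_real_diff_le {ℓ : Fin L} {t : ℕ}
    {F : Set (World Θ X)} (hF : MeasurableSet F) {ω : World Θ X} {ε : ℝ}
    (hpos : 0 < S.law.real {ω' | history ℓ t ω' = history ℓ t ω})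
    (hdiff : S.law.real ({ω' | history ℓ t ω' = history ℓ t ω} \ F) ≤
      ε * S.law.real {ω' | history ℓ t ω' = history ℓ t ω}) :
    1 - ε ≤ S.posterior ℓ t F ω := by
  refine le_of_mul_le_mul_right ?_ hpos
  rw [posterior_mul_law_real]
  have hsplit := measureReal_inter_add_sdiff (μ := S.law)
    (s := {ω' | history ℓ t ω' = history ℓ t ω}) hF
  linarith

variable [MeasurableSingletonClass Θ] {S} {Q : Set Θ}

theorem PairwiseFullSupport.isEvident_typicalEvent [∀ ℓ, Fintype (X ℓ)]
    (hS : S.PairwiseFullSupport)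
    (hQ : ∀ ℓ, ∀ θ ∈ Q, ∀ θ', S.marginal θ ℓ = S.marginal θ' ℓ → θ' ∈ Q) {m δ ε : ℝ} {t : ℕ}
    (hm₀ : 0 ≤ m) (hm : ∀ θ ℓ ℓ', ℓ ≠ ℓ' → ∀ a b, m ≤ S.condFreq θ ℓ ℓ' a b) (hδ : 0 ≤ δ)
    (hlik : ∀ ℓ θ θ', S.freq θ ℓ ≠ S.freq θ' ℓ → ∀ h : Fin t → X ℓ, IsTypical (S.freq θ ℓ) δ h →
      ∏ s, S.freq θ' ℓ (h s) ≤ Real.exp (-(t * δ)) * ∏ s, S.freq θ ℓ (h s))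
    (hcount : (∑ ℓ, Fintype.card (X ℓ) : ℕ) * (2 * Real.exp (-2 * t * (m * δ) ^ 2)) ≤ ε)
    (hprior : ∀ θ, Real.exp (-(t * δ)) ≤ ε * (S.prior θ).toReal) :
    S.IsEvident (1 - (ε + ε)) t (S.typicalEvent Q δ t) := by
  have hε : 0 ≤ ε := le_trans (by positivity) hcount
  rintro ω ⟨hωQ, htyp⟩
  refine Set.mem_iInter.2 fun ℓ => ?_
  set H : Set (World Θ X) := {ω' | history ℓ t ω' = history ℓ t ω} with hH
  have hpos : 0 < S.law.real H := by
    refine lt_of_lt_of_le (mul_pos (S.prior_toReal_pos ω.1) ?_)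
      (S.prior_mul_lawGiven_real_le_law_real ω.1 H)
    rw [hH, lawGiven_real_history_eq]
    exact Finset.prod_pos fun s _ => (htyp ℓ).1 s
  refine S.le_posterior_of_law_real_diff_le (S.measurableSet_typicalEvent Q δ t) hpos
    (S.law_real_le_mul_law_real hε hε fun θ => ?_)
  by_cases hagree : S.freq ω.1 ℓ = S.freq θ ℓ
  · have hθ : θ ∈ Q := hQ ℓ ω.1 hωQ θ (S.freq_eq_freq_iff.1 hagree)
    exact .inl <| (hS.lawGiven_real_history_diff_typicalEvent_le hθ hm₀ (hm θ) hδ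
      (hagree ▸ htyp ℓ)).trans (mul_le_mul_of_nonneg_right hcount measureReal_nonneg)
  · exact .inr <| (measureReal_mono Set.sdiff_subset).trans <|
      S.lawGiven_real_history_eq_le_mul_law_real hε (hlik ℓ ω.1 θ hagree _ (htyp ℓ)) (hprior ω.1)

theorem PairwiseFullSupport.commonlyLearned [∀ ℓ, Finite (X ℓ)] (hS : S.PairwiseFullSupport)
    (hQ : ∀ ℓ, ∀ θ ∈ Q, ∀ θ', S.marginal θ ℓ = S.marginal θ' ℓ → θ' ∈ Q) :
    S.CommonlyLearned Q := by
  have (ℓ : Fin L) : Fintype (X ℓ) := Fintype.ofFinite (X ℓ)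
  rintro q ⟨-, hq⟩
  obtain ⟨ε, hε, hqε⟩ : ∃ ε > 0, q = 1 - (ε + ε) := ⟨(1 - q) / 2, by linarith, by ring⟩
  obtain ⟨m, hm, hcard, hcond⟩ := hS.exists_le_condFreq
  have hsmall : ∀ᶠ δ : ℝ in 𝓝[>] 0, ∀ ℓ θ θ', S.freq θ ℓ ≠ S.freq θ' ℓ →
      ∀ t (h : Fin t → X ℓ), IsTypical (S.freq θ ℓ) δ h →
        ∏ s, S.freq θ' ℓ (h s) ≤ Real.exp (-(t * δ)) * ∏ s, S.freq θ ℓ (h s) := by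
    simp only [eventually_all]
    exact fun ℓ θ θ' hne => eventually_prod_le_exp_neg_mul_prod_of_isTypical
      (S.freq_mem_stdSimplex θ ℓ) (S.freq_mem_stdSimplex θ' ℓ) hne
  obtain ⟨δ, hδ, hlik⟩ := (eventually_mem_nhdsWithin.and hsmall).exists
  have hlarge := (eventually_mul_two_mul_exp_le (∑ ℓ, Fintype.card (X ℓ)) (mul_pos hm hδ) hε).and
    (eventually_all.2 fun θ =>
      eventually_exp_neg_mul_le hδ (mul_pos hε (S.prior_toReal_pos θ)))
  obtain ⟨T, hT⟩ := eventually_atTop.1 hlarge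
  refine ⟨T, S.typicalEvent Q δ, S.measurableSet_typicalEvent Q δ, fun t ht θ hθ => ?_⟩
  obtain ⟨hcount, hprior⟩ := hT t ht
  have hevident : S.IsEvident q t (S.typicalEvent Q δ t) := hqε ▸
    hS.isEvident_typicalEvent hQ hm.le hcond (le_of_lt hδ) (fun ℓ θ θ' hne => hlik ℓ θ θ' hne t)
      hcount hprior
  have hlikely : q < (S.lawGiven θ).real (S.typicalEvent Q δ t) := by
    have hcompl := S.lawGiven_real_compl_typicalEvent_le hθ hm.le hcard (le_of_lt hδ) t
    rw [probReal_compl_eq_one_sub (S.measurableSet_typicalEvent Q δ t)] at hcompl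
    linarith
  exact ⟨hevident.trans (S.belief_mono q t fun ω hω => hω.1), hlikely, hevident⟩

end Sufficiency

section Necessity

variable [Fintype Θ] [MeasurableSpace Θ] [∀ ℓ, MeasurableSpace (X ℓ)]

theorem history_preimage_image_agentBelief (q : ℝ) (ℓ : Fin L) (t : ℕ) (F : Set (World Θ X)) :
    history ℓ t ⁻¹' (history ℓ t '' S.agentBelief q ℓ t F) = S.agentBelief q ℓ t F := by
  refine Set.Subset.antisymm ?_ (Set.subset_preimage_image _ _)
  rintro ω ⟨ω', hω', heq⟩
  simpa only [agentBelief, posterior, Set.mem_ofPred_eq, heq] using hω'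

variable [∀ ℓ, MeasurableSingletonClass (X ℓ)]

theorem measurableSet_agentBelief [∀ ℓ, Countable (X ℓ)] (q : ℝ) (ℓ : Fin L) (t : ℕ)
    (F : Set (World Θ X)) : MeasurableSet (S.agentBelief q ℓ t F) := by
  rw [← history_preimage_image_agentBelief]
  exact measurable_history ℓ t (Set.to_countable _).measurableSet

theorem mul_law_real_agentBelief_le [∀ ℓ, Finite (X ℓ)] (q : ℝ) (ℓ : Fin L) (t : ℕ)
    (F : Set (World Θ X)) :
    q * S.law.real (S.agentBelief q ℓ t F) ≤ S.law.real (S.agentBelief q ℓ t F ∩ F) := by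
  have hmeas (h : Fin t → X ℓ) : MeasurableSet (history ℓ t ⁻¹' {h} : Set (World Θ X)) :=
    measurableSet_history_eq ℓ h
  obtain ⟨B, hB⟩ := (Set.toFinite (history ℓ t '' S.agentBelief q ℓ t F)).exists_finset_coe
  have hfibers : S.agentBelief q ℓ t F = history ℓ t ⁻¹' (B : Set (Fin t → X ℓ)) := by
    rw [hB, history_preimage_image_agentBelief]
  have hfiber (h : Fin t → X ℓ) (hh : h ∈ B) :
      q * S.law.real (history ℓ t ⁻¹' {h}) ≤ (S.law.restrict F).real (history ℓ t ⁻¹' {h}) := by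
    obtain ⟨ω, hω, rfl⟩ : h ∈ history ℓ t '' S.agentBelief q ℓ t F := hB ▸ hh
    rw [measureReal_restrict_apply (hmeas _)]
    exact (mul_le_mul_of_nonneg_right (Set.mem_ofPred.1 hω) measureReal_nonneg).trans_eq
      (S.posterior_mul_law_real ℓ t F ω)
  calc q * S.law.real (S.agentBelief q ℓ t F)
      = ∑ h ∈ B, q * S.law.real (history ℓ t ⁻¹' {h}) := by
        rw [← Finset.mul_sum, sum_measureReal_preimage_singleton _ fun h _ => hmeas h, ← hfibers]
    _ ≤ ∑ h ∈ B, (S.law.restrict F).real (history ℓ t ⁻¹' {h}) := Finset.sum_le_sum hfiber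
    _ = S.law.real (S.agentBelief q ℓ t F ∩ F) := by
        rw [sum_measureReal_preimage_singleton _ fun h _ => hmeas h, ← hfibers,
          measureReal_restrict_apply (S.measurableSet_agentBelief q ℓ t F)]

theorem lawGiven_real_agentBelief_congr [∀ ℓ, Countable (X ℓ)] {θ θ' : Θ} {ℓ : Fin L}
    (h : S.marginal θ ℓ = S.marginal θ' ℓ) (q : ℝ) (t : ℕ) (F : Set (World Θ X)) :
    (S.lawGiven θ).real (S.agentBelief q ℓ t F) = (S.lawGiven θ').real (S.agentBelief q ℓ t F) := by
  have hmeas : MeasurableSet (history ℓ t '' S.agentBelief q ℓ t F) :=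
    (Set.to_countable _).measurableSet
  rw [← history_preimage_image_agentBelief,
    ← map_measureReal_apply (measurable_history ℓ t) hmeas,
    ← map_measureReal_apply (measurable_history ℓ t) hmeas, map_history_lawGiven,
    map_history_lawGiven, h]

variable [MeasurableSingletonClass Θ]

theorem prior_mul_lawGiven_real_agentBelief_le [∀ ℓ, Finite (X ℓ)] {Q : Set Θ} {θ : Θ}
    (hθ : θ ∉ Q) {q : ℝ} (hq : q ≤ 1) (ℓ : Fin L) (t : ℕ) :
    (S.prior θ).toReal * (S.lawGiven θ).real (S.agentBelief q ℓ t (stateEvent X Q)) ≤ 1 - q := by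
  set E := S.agentBelief q ℓ t (stateEvent X Q)
  have houtside : (S.lawGiven θ).real (E \ stateEvent X Q) = (S.lawGiven θ).real E := by
    refine measureReal_congr (sdiff_ae_eq_self.2 (measure_eq_zero_iff_ae_notMem.2 ?_))
    filter_upwards [S.ae_fst_eq θ] with ω hω hmem
    exact hθ (hω ▸ hmem.2)
  have hQ : MeasurableSet (stateEvent X Q) := measurable_fst (Set.to_countable Q).measurableSet
  calc (S.prior θ).toReal * (S.lawGiven θ).real E
      ≤ S.law.real (E \ stateEvent X Q) :=
        houtside ▸ S.prior_mul_lawGiven_real_le_law_real θ _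
    _ ≤ (1 - q) * S.law.real E := by
        linarith [S.mul_law_real_agentBelief_le q ℓ t (stateEvent X Q),
          measureReal_inter_add_sdiff (μ := S.law) (s := E) hQ]
    _ ≤ 1 - q := mul_le_of_le_one_right (sub_nonneg.2 hq) measureReal_le_one

theorem CommonlyLearned.mem_of_marginal_eq [∀ ℓ, Finite (X ℓ)] {Q : Set Θ}
    (hQ : S.CommonlyLearned Q) {ℓ : Fin L} {θ θ' : Θ} (hθ : θ ∈ Q)
    (hmarginal : S.marginal θ ℓ = S.marginal θ' ℓ) : θ' ∈ Q := by
  by_contra hθ'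
  set p := (S.prior θ').toReal
  have hp : 0 < p := S.prior_toReal_pos θ'
  obtain ⟨q, hq, hpq⟩ : ∃ q ∈ Set.Ioo (0 : ℝ) 1, p * q = 1 - q :=
    ⟨1 / (1 + p), ⟨by positivity, (div_lt_one (by linarith)).2 (by linarith)⟩, by field_simp; ring⟩
  obtain ⟨T, F, -, hF⟩ := hQ q hq
  obtain ⟨hbelief, hlikely, -⟩ := hF T le_rfl θ hθ
  have hlt : q < (S.lawGiven θ').real (S.agentBelief q ℓ T (stateEvent X Q)) := by
    rw [← S.lawGiven_real_agentBelief_congr hmarginal]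
    exact hlikely.trans_le (measureReal_mono (hbelief.trans (Set.iInter_subset _ ℓ)))
  exact (mul_lt_mul_of_pos_left hlt hp).not_ge <|
    hpq ▸ S.prior_mul_lawGiven_real_agentBelief_le hθ' hq.2.le ℓ T

end Necessity

end InfoStructure

theorem proposition1 {Θ : Type*} [Fintype Θ] [MeasurableSpace Θ] [MeasurableSingletonClass Θ]
    {L : ℕ} {X : Fin L → Type*} [∀ ℓ, Fintype (X ℓ)] [∀ ℓ, MeasurableSpace (X ℓ)]
    [∀ ℓ, MeasurableSingletonClass (X ℓ)]
    (S : InfoStructure Θ X) (hS : S.PairwiseFullSupport) (Q : Set Θ) :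
    S.CommonlyLearned Q ↔ S.CommonlyIdentified Q := by
  rw [S.commonlyIdentified_iff]
  exact ⟨fun hQ _ _ hθ _ hmarginal => hQ.mem_of_marginal_eq S hθ hmarginal, hS.commonlyLearned⟩
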